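/- A ternary semigroup is a commutative monoid with elements $1,0,-1$ such that $x^3=x$, $x\cdot 0=0$, $(-1)(-1)=1\neq -1$, and $x=-x$ implies $x=0$ (with $-x:=(-1)x$). Let $F$ be an RS-fan, i.e. a real semigroup in the sense of Dickmann and Petrovich (a ternary semigroup with a ternary representation relation $a\in D_F(b,c)$ satisfying the real semigroup axioms) whose representation relation is $$D_F(a,b)=a\cdot\mathrm{Id}(F)\,\cup\, b\cdot\mathrm{Id}(F)\,\cup\,\{x\in F: xa=-xb \text{ and } x=a^2x\},\qquad \mathrm{Id}(F)=\{e\in F: e^2=e\}$$ (equivalently, a real semigroup whose set of characters is closed under products of three elements). Let $X_F$ be the set of its characters, i.e. of the homomorphisms of real semigroups $F\to\mathbf 3=\{1,0,-1\}$, with the spectral topology, whose subbasic open sets are $\{g\in X_F: g(a)=1\}$, $a\in F$. Write $g\rightsquigarrow h$ if $h$ is a specialization of $g$ (that is, $h\in\overline{\{g\}}$), and $Z(g)=g^{-1}[0]$. Let $\mathrm{Spec}(F)$ be the set of proper ideals of $F$ (non-empty subsets $I\not\ni 1$ with $F\cdot I\subseteq I$). For $J\subseteq I$ in $\mathrm{Spec}(F)$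 put $$S^I_J=\{h\in X_F: Z(h)=I \text{ and there is } g\in X_F \text{ with } g\rightsquigarrow h,\ Z(g)=J\},$$ $$C^I_J=\{h\in S^I_J: \text{for all } g'\in X_F,\ g'\rightsquigarrow h \text{ implies } J\subseteq Z(g')\}.$$ For $h\in X_F$ let $P_h=\{g\in X_F: g\rightsquigarrow h\}$, regarded as an abstract real spectrum (ARS) whose functions are the evaluations $\hat a|_{P_h}: g\mapsto g(a)$, $a\in F$. A map between ARSs $(X,G)\to(Y,H)$ is an ARS-morphism if composition with it carries each function in $H$ to a function in $G$; it is an ARS-embedding if moreover it is injective and every function in $G$ arises in this way from a function in $H$; it is an ARS-isomorphism if it is an ARS-morphism having an inverse that is an ARS-morphism. **Theorem.** Let $F$ be an RS-fan, let $J\subseteq I$ be in $\mathrm{Spec}(F)$, and let $h_1\in C^I_J$, $h_2\in S^I_J$. Then there is a map $\varphi:P_{h_1}\to P_{h_2}$ such that: 1. $\varphi$ is an ARS-embedding, with image $\varphi[P_{h_1}]=\{u\in P_{h_2}: J\subseteq Z(u)\}$. In particular $\varphi$ is an order-embedding of $(P_{h_1},\rightsquigarrow)$ into $(P_{h_2},\rightsquigarrow)$: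 $g\rightsquigarrow g'$ if and only if $\varphi(g)\rightsquigarrow\varphi(g')$. 2. If, in addition, $h_2\in C^I_J$, then $\varphi$ is an isomorphism of ARSs. -/

import Mathlib

open Set Topology

universe u v w

/-! ## Ternary semigroups and real semigroups -/

/-- A ternary semigroup: a commutative monoid with zero and a distinguished element `-1` such that
`x³ = x`, `-1 ≠ 1`, `(-1)(-1) = 1`, and `x = (-1)·x` implies `x = 0`.
The element `-1` is carried through the map `x ↦ -x = (-1)·x`; the laws of `HasDistribNeg`
(`- -x = x`, `(-x)y = -(xy) = x(-y)`) amount to `(-1)(-1) = 1`. -/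
class TernarySemigroup (S : Type u) extends CommMonoidWithZero S, HasDistribNeg S where
  cube_eq (x : S) : x * x * x = x
  neg_one_ne_one : (-1 : S) ≠ 1
  eq_zero_of_eq_neg (x : S) : x = -x → x = 0

/-- The transversal representation relation attached to a representation relation `D`:
`a ∈ Dᵗ(b, c)` iff `a ∈ D(b, c)`, `-b ∈ D(-a, c)` and `-c ∈ D(b, -a)`. -/
def transversalRep {S : Type u} [Neg S] (D : S → S → Set S) (b c : S) : Set S :=
  {a | a ∈ D b c ∧ -b ∈ D (-a) c ∧ -c ∈ D b (-a)}

/-- A real semigroup: a ternary semigroup with a ternary (representation) relation `a ∈ D(b, c)`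
subject to the axioms [RS0] -- [RS8] of Dickmann and Petrovich. -/
class RealSemigroup (G : Type u) extends TernarySemigroup G where
  /-- `D a b` is the set of elements represented by the form `⟨a, b⟩`. -/
  D : G → G → Set G
  rs0 (a b c : G) : c ∈ D a b ↔ c ∈ D b a
  rs1 (a b : G) : a ∈ D a b
  rs2 (a b c d : G) : a ∈ D b c → a * d ∈ D (b * d) (c * d)
  rs3 (a b c d e : G) : a ∈ transversalRep D b c → c ∈ transversalRep D d e →
    ∃ x ∈ transversalRep D b d, a ∈ transversalRep D x e
  rs4 (a b c d e : G) : e ∈ D (c * c * a) (d * d * b) → e ∈ D a b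
  rs5 (a b c d e : G) : a * d = b * d → a * e = b * e → c ∈ D d e → a * c = b * c
  rs6 (a b c : G) : c ∈ D a b → c ∈ transversalRep D (c * c * a) (c * c * b)
  rs7 (a b : G) : (transversalRep D a (-b) ∩ transversalRep D b (-a)).Nonempty → a = b
  rs8 (a b c : G) : a ∈ D b c → a * a ∈ D (b * b) (c * c)

/-- Transversal representation in a real semigroup. -/
def RealSemigroup.Dt {G : Type u} [RealSemigroup G] (b c : G) : Set G :=
  transversalRep (RealSemigroup.D) b c

/-- The three-element real semigroup `3 = {1, 0, -1}`, with
`D(0,0) = {0}`, `D(0,1) = D(1,0) = D(1,1) = {0,1}`, `D(0,-1) = D(-1,0) = D(-1,-1) = {0,-1}` and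
`D(1,-1) = D(-1,1) = {0,1,-1}`. -/
instance SignType.instRealSemigroup : RealSemigroup SignType where
  cube_eq := by decide
  neg_one_ne_one := by decide
  eq_zero_of_eq_neg := by decide
  D a b := {c | c = 0 ∨ c = a ∨ c = b}
  rs0 := by simp only [mem_ofPred_eq]; decide
  rs1 := by simp only [mem_ofPred_eq]; decide
  rs2 := by simp only [mem_ofPred_eq]; decide
  rs3 := by
    have key : ∀ s t u : SignType, s ∈ transversalRep
        (fun a b : SignType => ({c | c = 0 ∨ c = a ∨ c = b} : Set SignType)) t u ↔
        (decide (s = t ∧ (t = 0 → u = 0)) || decide (s = u ∧ (u = 0 → t = 0)) ||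
          decide (t = -u ∧ (t = 0 → s = 0))) = true := by
      simp only [transversalRep, mem_ofPred_eq]; decide
    simp only [key]; decide
  rs4 := by simp only [mem_ofPred_eq]; decide
  rs5 := by simp only [mem_ofPred_eq]; decide
  rs6 := by simp only [transversalRep, mem_ofPred_eq]; decide
  rs7 := by simp only [transversalRep, Set.Nonempty, mem_inter_iff, mem_ofPred_eq]; decide
  rs8 := by simp only [mem_ofPred_eq]; decide

/-- Homomorphisms of real semigroups: they preserve product, `1`, `0`, `-1` and the representation
relation. -/
structure RSHom (G : Type u) (H : Type v) [RealSemigroup G] [RealSemigroup H] extends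
    G →*₀ H where
  map_neg_one' : toFun (-1) = -1
  map_D' (a b c : G) : a ∈ RealSemigroup.D b c →
    toFun a ∈ RealSemigroup.D (toFun b) (toFun c)

instance {G : Type u} {H : Type v} [RealSemigroup G] [RealSemigroup H] :
    FunLike (RSHom G H) G H where
  coe f := f.toFun
  coe_injective f g h := by
    rcases f with ⟨f, _, _⟩
    rcases g with ⟨g, _, _⟩
    congr
    exact DFunLike.coe_injective h

/-- The character space `X_G` of a real semigroup: its homomorphisms into `3`. -/
abbrev RSChar (G : Type u) [RealSemigroup G] : Type u := RSHom G SignType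

/-- A fan in the category of real semigroups (RS-fan): the representation relation is
`D(a, b) = a·Id(F) ∪ b·Id(F) ∪ {x | x a = -x b and x = a² x}`, where `Id(F)` is the set of
idempotents of `F`. This is the smallest representation relation a real semigroup can carry on the
ternary semigroup `F`: all ternary semigroup homomorphisms `F → 3` are then characters, equivalently
the character space is closed under products of three elements. -/
class RSFan (F : Type u) extends RealSemigroup F where
  mem_D_iff (a b x : F) : x ∈ D a b ↔
    (∃ e, e * e = e ∧ x = a * e) ∨ (∃ e, e * e = e ∧ x = b * e) ∨ (x * a = -(x * b) ∧ x = a * a * x)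

/-- The set `Spec(F)` of proper ideals of `F` (every ideal contains `0`, that is, ideals are
non-empty). -/
def RSSpec (F : Type u) [RealSemigroup F] : Set (SemigroupIdeal F) :=
  {I | (0 : F) ∈ I ∧ (1 : F) ∉ I}

section Characters

variable {F : Type u} [RealSemigroup F]

/-- The spectral topology on the character space, with the sets `{g | g(a) = 1}` as a subbasis.
`g ⤳ h` is Mathlib's specialization relation: `h` lies in the closure of `{g}`. -/
instance RSChar.instTopologicalSpace : TopologicalSpace (RSChar F) :=
  TopologicalSpace.generateFrom {U | ∃ a : F, U = {g : RSChar F | g a = 1}}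

/-- The zero-set `Z(g) = g⁻¹[0]`. -/
def RSChar.zeros (g : RSChar F) : Set F := {a | g a = 0}

/-- The `I`-th level `L_I = {h | Z(h) = I}`. -/
def levelSet (I : SemigroupIdeal F) : Set (RSChar F) := {h | h.zeros = (I : Set F)}

/-- `S^I_J`: the characters of level `I` having a predecessor of level `J`. -/
def levelS (I J : SemigroupIdeal F) : Set (RSChar F) :=
  {h | h ∈ levelSet I ∧ ∃ g : RSChar F, g ⤳ h ∧ g.zeros = (J : Set F)}

/-- `C^I_J`: the members of `S^I_J` all of whose predecessors `g'` satisfy `J ⊆ Z(g')`. -/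
def levelC (I J : SemigroupIdeal F) : Set (RSChar F) :=
  {h | h ∈ levelS I J ∧ ∀ g' : RSChar F, g' ⤳ h → (J : Set F) ⊆ g'.zeros}

/-- The set `P_h` of predecessors of `h` under specialization. -/
def predecessors (h : RSChar F) : Set (RSChar F) := {g | g ⤳ h}

end Characters

/-! ## Abstract real spectra -/

/-- `D(a, b)` in a set `G` of functions `X → 3`, computed pointwise in `3`. -/
def funRep {X : Type u} (G : Set (X → SignType)) (a b : X → SignType) : Set (X → SignType) :=
  {c | c ∈ G ∧ ∀ x, c x ∈ RealSemigroup.D (a x) (b x)}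

/-- `Dᵗ(a, b)` in a set `G` of functions `X → 3`, computed pointwise in `3`. -/
def funTransRep {X : Type u} (G : Set (X → SignType)) (a b : X → SignType) :
    Set (X → SignType) :=
  {c | c ∈ G ∧ ∀ x, c x ∈ RealSemigroup.Dt (a x) (b x)}

/-- An abstract real spectrum (Marshall): a non-empty set `X` with a monoid `G` of functions
`X → {1, 0, -1}` satisfying the axioms AX1, AX2, AX3. -/
structure AbstractRealSpectrum where
  X : Type u
  G : Submonoid (X → SignType)
  nonempty : Nonempty X
  zero_mem : (0 : X → SignType) ∈ G
  neg_one_mem : (-1 : X → SignType) ∈ G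
  separates (x y : X) : x ≠ y → ∃ a ∈ G, a x ≠ a y
  ax2 (P : Submonoid (X → SignType)) :
    P ≤ G → (∀ a ∈ G, a ∈ P ∨ -a ∈ P) → (-1 : X → SignType) ∉ P →
    (∀ a ∈ P, ∀ b ∈ P, funRep (G : Set (X → SignType)) a b ⊆ (P : Set (X → SignType))) →
    (∀ a ∈ G, ∀ b ∈ G, (a * b ∈ P ∧ -(a * b) ∈ P) → (a ∈ P ∧ -a ∈ P) ∨ (b ∈ P ∧ -b ∈ P)) →
    ∃ x : X, ∀ a ∈ G, a ∈ P ↔ 0 ≤ a x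
  ax3 (a b c p q : X → SignType) : a ∈ G → b ∈ G → c ∈ G →
    q ∈ funTransRep (G : Set (X → SignType)) b c →
    p ∈ funTransRep (G : Set (X → SignType)) a q →
    ∃ r ∈ funTransRep (G : Set (X → SignType)) a b,
      p ∈ funTransRep (G : Set (X → SignType)) r c

namespace AbstractRealSpectrum

/-- `φ : (X, G) → (Y, H)` is an ARS-morphism iff every `a ∈ H` pulls back along `φ` to an
element of `G`. -/
def IsMorphism (A : AbstractRealSpectrum.{u}) (B : AbstractRealSpectrum.{v}) (φ : A.X → B.X) :
    Prop :=
  ∀ a ∈ B.G, a ∘ φ ∈ A.G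

/-- `φ : (X, G) → (Y, H)` is an ARS-embedding: an injective ARS-morphism which identifies `X` with
its image, the functions `G` on `X` being exactly the restrictions of those in `H`. -/
structure IsEmbedding (A : AbstractRealSpectrum.{u}) (B : AbstractRealSpectrum.{v})
    (φ : A.X → B.X) : Prop where
  isMorphism : A.IsMorphism B φ
  injective : Function.Injective φ
  lifts : ∀ b ∈ A.G, ∃ a ∈ B.G, a ∘ φ = b

/-- `φ` is an ARS-isomorphism: an ARS-morphism with an inverse that is an ARS-morphism. -/
def IsIso (A : AbstractRealSpectrum.{u}) (B : AbstractRealSpectrum.{v}) (φ : A.X → B.X) : Prop :=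
  A.IsMorphism B φ ∧ ∃ ψ : B.X → A.X, B.IsMorphism A ψ ∧
    Function.LeftInverse ψ φ ∧ Function.RightInverse ψ φ

end AbstractRealSpectrum

/-! ## The predecessor fan `P_h` as an abstract real spectrum -/

theorem RSChar.specializes_iff {F : Type u} [RealSemigroup F] (g h : RSChar F) :
    g ⤳ h ↔ ∀ a, h a = 1 → g a = 1 := by
  rw [specializes_iff_forall_open]
  constructor
  · intro H a ha
    exact H {f | f a = 1} (TopologicalSpace.isOpen_generateFrom_of_mem ⟨a, rfl⟩) ha
  · intro H s hs
    induction hs with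
    | basic s hs => obtain ⟨a, rfl⟩ := hs; exact H a
    | univ => exact fun _ => trivial
    | inter s t _ _ h1 h2 => exact fun hx => ⟨h1 hx.1, h2 hx.2⟩
    | sUnion S _ ih => rintro ⟨s, hs, hx⟩; exact ⟨s, hs, ih s hs hx⟩

section Fan

variable {F : Type u}

@[simp] theorem RSChar.map_mul' [RealSemigroup F] (g : RSChar F) (a b : F) :
    g (a * b) = g a * g b := g.toMonoidWithZeroHom.map_mul a b

@[simp] theorem RSChar.map_one' [RealSemigroup F] (g : RSChar F) : g 1 = 1 :=
  g.toMonoidWithZeroHom.map_one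

@[simp] theorem RSChar.map_zero' [RealSemigroup F] (g : RSChar F) : g 0 = 0 :=
  g.toMonoidWithZeroHom.map_zero

@[simp] theorem RSChar.map_neg' [RealSemigroup F] (g : RSChar F) (a : F) : g (-a) = -g a := by
  rw [← neg_one_mul, RSChar.map_mul', show g (-1) = -1 from g.map_neg_one', neg_one_mul]

/-- In an RS-fan every homomorphism of ternary semigroups into `3` is a character. -/
def RSFan.mkChar [RSFan F] (f : F →*₀ SignType) (hf : f (-1) = -1) : RSChar F where
  toMonoidWithZeroHom := f
  map_neg_one' := hf
  map_D' x a b hx := by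
    have hneg (y : F) : f (-y) = -f y := by rw [← neg_one_mul, map_mul, hf, neg_one_mul]
    change f x = 0 ∨ f x = f a ∨ f x = f b
    rcases (RSFan.mem_D_iff a b x).1 hx with ⟨e, he, rfl⟩ | ⟨e, he, rfl⟩ | ⟨h1, h2⟩
    · have := congrArg f he
      rw [map_mul] at this ⊢
      revert this; generalize f e = s; generalize f a = t; generalize f b = r
      revert s t r; decide
    · have := congrArg f he
      rw [map_mul] at this ⊢
      revert this; generalize f e = s; generalize f a = t; generalize f b = r
      revert s t r; decide
    · have h1 := congrArg f h1
      have h2 := congrArg f h2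
      rw [hneg] at h1
      simp only [map_mul] at h1 h2
      revert h1 h2; generalize f x = s; generalize f a = t; generalize f b = r
      revert s t r; decide

/-- In an RS-fan the product of three characters is a character. -/
def RSFan.mul3 [RSFan F] (g₁ g₂ g₃ : RSChar F) : RSChar F :=
  RSFan.mkChar
    { toFun := fun a => g₁ a * g₂ a * g₃ a
      map_zero' := by simp
      map_one' := by simp
      map_mul' := fun a b => by simp only [RSChar.map_mul']; ac_rfl } (by
      change g₁ (-1) * g₂ (-1) * g₃ (-1) = -1
      simp)

theorem RSFan.mul3_apply [RSFan F] (g₁ g₂ g₃ : RSChar F) (a : F) :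
    RSFan.mul3 g₁ g₂ g₃ a = g₁ a * g₂ a * g₃ a := rfl

theorem RSFan.mul3_mem [RSFan F] {h g₁ g₂ g₃ : RSChar F} (h₁ : g₁ ∈ predecessors h)
    (h₂ : g₂ ∈ predecessors h) (h₃ : g₃ ∈ predecessors h) :
    RSFan.mul3 g₁ g₂ g₃ ∈ predecessors h := by
  simp only [predecessors, mem_ofPred_eq, RSChar.specializes_iff] at *
  intro a ha
  rw [RSFan.mul3_apply, h₁ a ha, h₂ a ha, h₃ a ha]; rfl

theorem RealSemigroup.Dt_nonempty [RealSemigroup F] (a b : F) :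
    (RealSemigroup.Dt a b).Nonempty := by
  have h0 : ∀ x y : F, (0 : F) ∈ RealSemigroup.D x y := fun x y =>
    RealSemigroup.rs4 x y 0 0 0 (by simpa using RealSemigroup.rs1 (0 : F) 0)
  have h1 : a ∈ transversalRep RealSemigroup.D a (0 : F) := by
    have := RealSemigroup.rs6 a 0 a (RealSemigroup.rs1 a 0)
    rwa [TernarySemigroup.cube_eq, mul_zero] at this
  have h2 : (0 : F) ∈ transversalRep RealSemigroup.D b (-b) := by
    refine ⟨h0 _ _, ?_, ?_⟩
    · rw [RealSemigroup.rs0]; exact RealSemigroup.rs1 _ _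
    · rw [neg_neg]; exact RealSemigroup.rs1 _ _
  obtain ⟨x, hx, -⟩ := RealSemigroup.rs3 a a 0 b (-b) h1 h2
  exact ⟨x, hx⟩

/-- In an RS-fan the principal ideals, hence all ideals, are totally ordered. -/
theorem RSFan.sq_mul_sq [RSFan F] (a b : F) :
    a * a * (b * b) = a * a ∨ a * a * (b * b) = b * b := by
  have id2 : ∀ x : F, x * x * (x * x) = x * x := fun x => by
    rw [← mul_assoc, TernarySemigroup.cube_eq]
  have key : ∀ e f x : F, e * e = e → f * f = f → -e ∈ RealSemigroup.D (-x) f →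
      e * (x * x) = e := by
    intro e f x he hf h
    rcases (RSFan.mem_D_iff _ _ _).1 h with ⟨i, hi, h⟩ | ⟨i, hi, h⟩ | ⟨-, h⟩
    · have h' : e = x * i := by simpa using congrArg Neg.neg h
      calc e * (x * x) = (x * x * x) * i := by rw [h']; ac_rfl
        _ = e := by rw [TernarySemigroup.cube_eq, h']
    · have h' : -e = e := by
        calc -e = (f * f) * (i * i) := by rw [hf, hi, h]
          _ = (f * i) * (f * i) := by ac_rfl
          _ = e := by rw [← h]; simp [he]
      rw [TernarySemigroup.eq_zero_of_eq_neg e h'.symm, zero_mul]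
    · have h' : e = x * x * e := by simpa using congrArg Neg.neg h
      rw [mul_comm]; exact h'.symm
  set e := a * a with he
  set f := b * b with hf
  have hee : e * e = e := id2 a
  have hff : f * f = f := id2 b
  obtain ⟨x, h1, h2, h3⟩ := RealSemigroup.Dt_nonempty e f
  have k1 := key e f x hee hff h2
  have k2 := key f e x hff hee (by rwa [RealSemigroup.rs0])
  have aux : ∀ e f : F, f * (x * x) = f → (∃ i, i * i = i ∧ x = e * i) → e * f * e = f * e →
      e * e = e → e * f = f := by
    rintro e f hf ⟨i, -, hx⟩ - he
    calc e * f = e * (f * (x * x)) := by rw [hf]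
      _ = f * ((e * e) * i * x) := by nth_rw 1 [hx]; ac_rfl
      _ = f * (x * x) := by rw [he, ← hx]
      _ = f := hf
  rcases (RSFan.mem_D_iff _ _ _).1 h1 with h | h | ⟨-, h⟩
  · right; exact aux e f k2 h (by rw [mul_assoc, mul_comm, mul_assoc, hee]) hee
  · left; rw [mul_comm]; exact aux f e k1 h (by rw [mul_assoc, mul_comm, mul_assoc, hff]) hff
  · right
    rw [hee] at h
    calc e * f = e * (f * (x * x)) := by rw [k2]
      _ = f * ((e * x) * x) := by ac_rfl
      _ = f * (x * x) := by rw [← h]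
      _ = f := k2

theorem SignType.mem_Dt_iff (s t u : SignType) : s ∈ RealSemigroup.Dt t u ↔
    (s = t ∧ (t = 0 → u = 0)) ∨ (s = u ∧ (u = 0 → t = 0)) ∨ (t = -u ∧ (t = 0 → s = 0)) := by
  change (s = 0 ∨ s = t ∨ s = u) ∧ (-t = 0 ∨ -t = -s ∨ -t = u) ∧ (-u = 0 ∨ -u = t ∨ -u = -s) ↔ _
  revert s t u; decide

/-- Evaluation of the elements of `F` on `P_h`, as functions `P_h → 3`. -/
def predecessorEval [RealSemigroup F] (h : RSChar F) : F →* (predecessors h → SignType) where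
  toFun a g := g.1 a
  map_one' := by ext g; simp
  map_mul' a b := by ext g; simp

set_option synthInstance.maxSize 1000 in
theorem RSFan.mem_Dt_iff [RSFan F] (h : RSChar F) (b c q : F) :
    (∀ x ∈ predecessors h, x q ∈ RealSemigroup.Dt (x b) (x c)) ↔
      ((∀ x ∈ predecessors h, x q = x b) ∧ (∀ x ∈ predecessors h, x b = 0 → x c = 0)) ∨
      ((∀ x ∈ predecessors h, x q = x c) ∧ (∀ x ∈ predecessors h, x c = 0 → x b = 0)) ∨
      ((∀ x ∈ predecessors h, x b = -x c) ∧ (∀ x ∈ predecessors h, x b = 0 → x q = 0)) := by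
  simp only [SignType.mem_Dt_iff]
  constructor
  · intro H
    have HH : ∀ x ∈ predecessors h, ∀ y ∈ predecessors h, ∀ z ∈ predecessors h, _ :=
      fun x hx y hy z hz => H _ (RSFan.mul3_mem hx hy hz)
    simp only [RSFan.mul3_apply] at HH
    by_cases hbc : ∀ x ∈ predecessors h, x b = 0 → x c = 0
    · by_cases hcb : ∀ x ∈ predecessors h, x c = 0 → x b = 0
      · by_cases h0 : ∀ x ∈ predecessors h, x b = -x c
        · right; right
          refine ⟨h0, fun x hx => ?_⟩
          have := H x hx; have := h0 x hx
          grind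
        · push Not at h0
          obtain ⟨x, hx, h0⟩ := h0
          by_cases h1 : ∀ y ∈ predecessors h, y q = y b
          · exact Or.inl ⟨h1, hbc⟩
          by_cases h2 : ∀ y ∈ predecessors h, y q = y c
          · exact Or.inr (Or.inl ⟨h2, hcb⟩)
          exfalso
          push Not at h1 h2
          obtain ⟨y, hy, h1⟩ := h1
          obtain ⟨z, hz, h2⟩ := h2
          have hx1 : x q = x b ∧ x b = x c ∧ x b ≠ 0 := by
            have e1 := H x hx
            have e2 := hbc x hx
            have e3 := hcb x hx
            revert h0 e1 e2 e3
            generalize x q = q'; generalize x b = b'; generalize x c = c'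
            revert q' b' c'; decide
          have aux : ∀ y ∈ predecessors h, (y q = y b ∨ y q = y c) ∧ (y q = 0 → y b = 0) := by
            intro y hy
            have e2 := H y hy
            have e3 := HH x hx y hy y hy
            rw [hx1.1, ← hx1.2.1] at e3
            have e4 := hx1.2.2
            revert e2 e3 e4
            generalize x b = b'
            generalize y q = q''; generalize y b = b''; generalize y c = c''
            revert b' q'' b'' c''; decide
          have f2 : y q = y c ∧ y b = -y q ∧ y q ≠ 0 := by
            have e1 := H y hy
            have e2 := aux y hy
            have e3 := hbc y hy
            have e4 := hcb y hy
            revert h1 e1 e2 e3 e4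
            generalize y q = q'; generalize y b = b'; generalize y c = c'
            revert q' b' c'; decide
          have f3 : z q = z b ∧ z c = -z q ∧ z q ≠ 0 := by
            have e1 := H z hz
            have e2 := aux z hz
            have e3 := hbc z hz
            have e4 := hcb z hz
            revert h2 e1 e2 e3 e4
            generalize z q = q'; generalize z b = b'; generalize z c = c'
            revert q' b' c'; decide
          have e := HH x hx y hy z hz
          rw [hx1.1, ← hx1.2.1, ← f2.1, f2.2.1, ← f3.1, f3.2.1] at e
          have g1 := hx1.2.2
          have g2 := f2.2.2
          have g3 := f3.2.2
          revert e g1 g2 g3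
          generalize x b = r; generalize y q = s; generalize z q = t
          revert r s t; decide
      · left
        push Not at hcb
        obtain ⟨x, hx, hc, hb⟩ := hcb
        refine ⟨fun y hy => ?_, hbc⟩
        have e1 := H x hx
        have e2 := H y hy
        have e3 := HH x hx x hx y hy
        rw [hc] at e1 e3
        have e4 : x q = x b := by
          revert hb e1
          generalize x q = q'; generalize x b = b'
          revert q' b'; decide
        rw [e4] at e3
        revert hb e2 e3
        generalize x b = b'
        generalize y q = q''; generalize y b = b''; generalize y c = c''
        revert b' q'' b'' c''; decide
    · right; left
      push Not at hbc
      obtain ⟨x, hx, hb, hc⟩ := hbc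
      have hcb : ∀ y ∈ predecessors h, y c = 0 → y b = 0 := by
        intro y hy hy0
        rcases RSFan.sq_mul_sq b c with e | e
        · have := congrArg y e
          simpa [hy0] using this
        · have := congrArg x e
          simp [hb, hc] at this
      refine ⟨fun y hy => ?_, hcb⟩
      have e1 := H x hx
      have e2 := H y hy
      have e3 := HH x hx x hx y hy
      rw [hb] at e1 e3
      have e4 : x q = x c := by
        revert hc e1
        generalize x q = q'; generalize x c = c'
        revert q' c'; decide
      rw [e4] at e3
      revert hc e2 e3
      generalize x c = b'
      generalize y q = q''; generalize y b = b''; generalize y c = c''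
      revert b' q'' b'' c''; decide
  · rintro (⟨h1, h2⟩ | ⟨h1, h2⟩ | ⟨h1, h2⟩) x hx
    · exact Or.inl ⟨h1 x hx, h2 x hx⟩
    · exact Or.inr (Or.inl ⟨h1 x hx, h2 x hx⟩)
    · exact Or.inr (Or.inr ⟨h1 x hx, h2 x hx⟩)

theorem RSFan.zeros_total [RSFan F] (S : Set (RSChar F)) (a b : F) :
    (∀ x ∈ S, x a = 0 → x b = 0) ∨ (∀ x ∈ S, x b = 0 → x a = 0) := by
  rcases RSFan.sq_mul_sq a b with e | e
  · right; intro x _ h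
    simpa [h] using congrArg x e
  · left; intro x _ h
    simpa [h] using congrArg x e

/-- The strong associativity axiom on `P_h`. -/
theorem RSFan.assoc_predecessors [RSFan F] (h : RSChar F) (a b c p q : F)
    (hq : ∀ x ∈ predecessors h, x q ∈ RealSemigroup.Dt (x b) (x c))
    (hp : ∀ x ∈ predecessors h, x p ∈ RealSemigroup.Dt (x a) (x q)) :
    ∃ r : F, (∀ x ∈ predecessors h, x r ∈ RealSemigroup.Dt (x a) (x b)) ∧
      (∀ x ∈ predecessors h, x p ∈ RealSemigroup.Dt (x r) (x c)) := by
  have hab := RSFan.zeros_total (predecessors h) a b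
  have hpc := RSFan.zeros_total (predecessors h) p c
  have hz : ∀ s t : SignType, s = -t → (s = 0 ↔ t = 0) := by decide
  have hz1 : ∀ x ∈ predecessors h, x b = -x c → (x b = 0 ↔ x c = 0) := fun x _ e => hz _ _ e
  have hz2 : ∀ x ∈ predecessors h, x a = -x q → (x a = 0 ↔ x q = 0) := fun x _ e => hz _ _ e
  have hz3 : ∀ x ∈ predecessors h, (x (-c) = 0 ↔ x c = 0) ∧ x (-c) = -x c := fun x _ =>
    ⟨hz _ _ (RSChar.map_neg' x c), RSChar.map_neg' x c⟩
  simp only [RSFan.mem_Dt_iff] at hp hq ⊢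
  rcases hq with ⟨q1, q2⟩ | ⟨q1, q2⟩ | ⟨q1, q2⟩
  · rcases hp with ⟨p1, p2⟩ | ⟨p1, p2⟩ | ⟨p1, p2⟩
    · refine ⟨p, ?_, ?_⟩ <;> grind
    · refine ⟨p, ?_, ?_⟩ <;> grind
    · rcases hpc with hpc | hpc
      · refine ⟨p, ?_, ?_⟩ <;> grind
      · refine ⟨-c, Or.inr (Or.inr ⟨?_, ?_⟩), Or.inr (Or.inr ⟨?_, ?_⟩)⟩ <;> grind
  · rcases hp with ⟨p1, p2⟩ | ⟨p1, p2⟩ | ⟨p1, p2⟩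
    · refine ⟨a, ?_, ?_⟩ <;> grind
    · rcases hab with hab | hab
      · refine ⟨a, ?_, ?_⟩ <;> grind
      · refine ⟨b, ?_, ?_⟩ <;> grind
    · refine ⟨a, ?_, ?_⟩ <;> grind
  · rcases hp with ⟨p1, p2⟩ | ⟨p1, p2⟩ | ⟨p1, p2⟩
    · rcases hab with hab | hab
      · refine ⟨a, ?_, ?_⟩ <;> grind
      · refine ⟨b, ?_, ?_⟩ <;> grind
    · refine ⟨b, ?_, ?_⟩ <;> grind
    · refine ⟨b, ?_, ?_⟩ <;> grind

theorem SignType.ite_mul_ite (A A' B B' C C' : Prop) [Decidable A] [Decidable A'] [Decidable B]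
    [Decidable B'] [Decidable C] [Decidable C'] (ha : A ∨ A') (hb : B ∨ B')
    (m1 : A → B → C) (m2 : A → B' → C') (m3 : A' → B → C') (m4 : A' → B' → C)
    (pr : C ∧ C' → (A ∧ A') ∨ (B ∧ B')) :
    (if C then (if C' then 0 else 1) else -1 : SignType) =
      (if A then (if A' then 0 else 1) else -1) * (if B then (if B' then 0 else 1) else -1) := by
  by_cases A <;> by_cases A' <;> by_cases B <;> by_cases B' <;> simp_all

open Classical in
/-- A prime cone of functions on `P_h` comes from a point of `P_h`. -/
theorem RSFan.exists_point [RSFan F] (h : RSChar F) (P : Submonoid (predecessors h → SignType))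
    (hP : ∀ a : F, predecessorEval h a ∈ P ∨ -predecessorEval h a ∈ P)
    (hP1 : (-1 : predecessors h → SignType) ∉ P)
    (hprime : ∀ a b : F, (predecessorEval h (a * b) ∈ P ∧ -predecessorEval h (a * b) ∈ P) →
      (predecessorEval h a ∈ P ∧ -predecessorEval h a ∈ P) ∨
      (predecessorEval h b ∈ P ∧ -predecessorEval h b ∈ P)) :
    ∃ x : predecessors h, ∀ a : F, predecessorEval h a ∈ P ↔ 0 ≤ predecessorEval h a x := by
  set E := predecessorEval h with hE
  let f : F → SignType := fun a => if E a ∈ P then (if -E a ∈ P then 0 else 1) else -1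
  have hneg (a : F) : E (-a) = -E a := by ext g; simp [hE, predecessorEval]
  have hmul (a b : F) : f (a * b) = f a * f b := by
    have e0 : E (a * b) = E a * E b := map_mul E a b
    have pr := hprime a b
    have ha := hP a
    have hb := hP b
    rw [e0] at pr
    have m1 : E a ∈ P → E b ∈ P → E a * E b ∈ P := fun x y => P.mul_mem x y
    have m2 : E a ∈ P → -E b ∈ P → -(E a * E b) ∈ P := fun x y => by
      simpa using P.mul_mem x y
    have m3 : -E a ∈ P → E b ∈ P → -(E a * E b) ∈ P := fun x y => by
      simpa using P.mul_mem x y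
    have m4 : -E a ∈ P → -E b ∈ P → E a * E b ∈ P := fun x y => by
      simpa using P.mul_mem x y
    simp only [f, e0]
    exact SignType.ite_mul_ite _ _ _ _ _ _ ha hb m1 m2 m3 m4 pr
  have hone : E 1 = 1 := map_one E
  have h0 : E 0 = 0 := by ext g; simp [hE, predecessorEval]
  have f1 : f 1 = 1 := by simp [f, hone, P.one_mem, hP1]
  have f0 : f 0 = 0 := by
    have := hP 0
    simp only [h0, neg_zero, or_self] at this
    simp [f, h0, this]
  have fn1 : f (-1) = -1 := by simp [f, hneg, hone, hP1]
  let g : RSChar F := RSFan.mkChar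
    { toFun := f, map_zero' := f0, map_one' := f1, map_mul' := hmul } fn1
  have hg : g ∈ predecessors h := by
    refine (RSChar.specializes_iff g h).2 fun a ha => ?_
    have : E a = 1 := by
      funext x
      exact (RSChar.specializes_iff x.1 h).1 x.2 a ha
    change f a = 1
    simp [f, this, P.one_mem, hP1]
  refine ⟨⟨g, hg⟩, fun a => ?_⟩
  change _ ↔ 0 ≤ f a
  simp only [f]
  split_ifs with u v <;> simp [u]

/-- The abstract real spectrum `P_h`: its points are the predecessors of `h`, its functions are
the evaluations at elements of `F`. -/
def predecessorFan [RSFan F] (h : RSChar F) : AbstractRealSpectrum.{u} where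
  X := predecessors h
  G := MonoidHom.mrange (predecessorEval h)
  nonempty := ⟨⟨h, specializes_rfl⟩⟩
  zero_mem := ⟨0, funext fun g => RSChar.map_zero' g.1⟩
  neg_one_mem := ⟨-1, by ext g; simp [predecessorEval]⟩
  separates x y hxy := by
    by_contra H
    push Not at H
    exact hxy (Subtype.ext (DFunLike.ext _ _ fun a => H _ ⟨a, rfl⟩))
  ax2 P _ h2 h3 _ h5 := by
    obtain ⟨x, hx⟩ := RSFan.exists_point h P (fun a => h2 _ ⟨a, rfl⟩) h3 (fun a b hab =>
      h5 _ ⟨a, rfl⟩ _ ⟨b, rfl⟩ (by rwa [map_mul] at hab))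
    refine ⟨x, ?_⟩
    rintro _ ⟨a, rfl⟩
    exact hx a
  ax3 := by
    rintro _ _ _ _ _ ⟨a, rfl⟩ ⟨b, rfl⟩ ⟨c, rfl⟩ ⟨⟨q, rfl⟩, hq⟩ ⟨⟨p, rfl⟩, hp⟩
    obtain ⟨r, h1, h2⟩ := RSFan.assoc_predecessors h a b c p q
      (fun x hx => hq ⟨x, hx⟩) (fun x hx => hp ⟨x, hx⟩)
    exact ⟨predecessorEval h r, ⟨⟨r, rfl⟩, fun x => h1 x.1 x.2⟩, ⟨p, rfl⟩, fun x => h2 x.1 x.2⟩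

end Fan

/-! Choose `g₁ ⤳ h₁` and `g₂ ⤳ h₂`, both with zero-set `J`. In a fan a product of three characters
is a character, so one can twist by the pair: `φ u = u g₁ g₂`, with `ψ u = u g₂ g₁` in the other
direction. A generization agrees with its specialization wherever the latter is nonzero. Hence off
`I` the product `u g₁ g₂` equals `h₁ h₁ h₂ = h₂`, and `φ` lands in the predecessors of `h₂`
(`RSFan.mul3_mem_predecessors`).

Applying both twists multiplies `u` by `g₁² g₂²`, which is the indicator of the complement of `J`.
So the round trip fixes `u` as soon as `J ⊆ Z(u)` (`RSFan.mul3_mul3_cancel`). Membership of `h₁` in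
`C^I_J` ensures this for every predecessor of `h₁`, so `ψ` is a left inverse of `φ`. On the `h₂`
side it holds on the stated image, and everywhere if `h₂` is also in `C^I_J`.

Each twist is a morphism and preserves specialization because it turns an evaluation into an
evaluation (`RSFan.exists_mul3_apply_eq`). -/

/-- Specialization transports the value `1` backwards; applied to `-a`, it transports the value `-1`
as well. -/
theorem RSChar.eq_of_specializes {F : Type u} [RealSemigroup F] {g h : RSChar F} (hgh : g ⤳ h)
    {a : F} (ha : h a ≠ 0) : g a = h a := by
  rw [RSChar.specializes_iff] at hgh
  have h1 := hgh a
  have h2 := hgh (-a)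
  rw [RSChar.map_neg', RSChar.map_neg'] at h2
  revert ha h1 h2
  generalize g a = s; generalize h a = t
  revert s t; decide

/-! ### Twisting by a pair of characters -/

/-- Pulling back an evaluation along `u ↦ u g₁ g₂` gives an evaluation. -/
theorem RSFan.exists_mul3_apply_eq {F : Type u} [RSFan F] (g₁ g₂ : RSChar F) (a : F) :
    ∃ b : F, ∀ u : RSChar F, RSFan.mul3 u g₁ g₂ a = u b := by
  simp only [RSFan.mul3_apply, mul_assoc]
  -- The factor `g₁ a * g₂ a` is a constant sign independent of `u`; it is absorbed into `a`.
  rcases SignType.trichotomy (g₁ a * g₂ a) with h | h | h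
  · exact ⟨-a, fun u => by simp [h]⟩
  · exact ⟨0, fun u => by simp [h]⟩
  · exact ⟨a, fun u => by simp [h]⟩

/-- Specialization is tested on evaluations alone, and each evaluation of the twist is an evaluation
of the original character at one element common to `u` and `v`. -/
theorem RSFan.mul3_specializes_mul3 {F : Type u} [RSFan F] (g₁ g₂ : RSChar F) {u v : RSChar F}
    (huv : u ⤳ v) : RSFan.mul3 u g₁ g₂ ⤳ RSFan.mul3 v g₁ g₂ := by
  rw [RSChar.specializes_iff] at huv ⊢
  intro a
  obtain ⟨b, hb⟩ := RSFan.exists_mul3_apply_eq g₁ g₂ a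
  rw [hb, hb]
  exact huv b

/-- Off the common zero-set, `u` and `g₁` both equal `h₁` and cancel, as `h₁² = 1` there; what
remains is `g₂ = h₂`. -/
theorem RSFan.mul3_mem_predecessors {F : Type u} [RSFan F] {h₁ h₂ g₁ g₂ u : RSChar F}
    (hz : h₁.zeros = h₂.zeros) (hu : u ∈ predecessors h₁) (hg₁ : g₁ ⤳ h₁) (hg₂ : g₂ ⤳ h₂) :
    RSFan.mul3 u g₁ g₂ ∈ predecessors h₂ := by
  refine (RSChar.specializes_iff _ _).2 fun a ha => ?_
  have h2 : h₂ a ≠ 0 := by rw [ha]; decide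
  have h1 : h₁ a ≠ 0 := fun h => h2 ((Set.ext_iff.1 hz a).1 h)
  rw [RSFan.mul3_apply, RSChar.eq_of_specializes hu h1, RSChar.eq_of_specializes hg₁ h1,
    RSChar.eq_of_specializes hg₂ h2, ha]
  revert h1; generalize h₁ a = s; revert s; decide

theorem RSFan.subset_zeros_mul3 {F : Type u} [RSFan F] {J : Set F} {u : RSChar F}
    (g₁ g₂ : RSChar F) (hu : J ⊆ u.zeros) : J ⊆ (RSFan.mul3 u g₁ g₂).zeros := by
  intro a ha
  have : u a = 0 := hu ha
  change RSFan.mul3 u g₁ g₂ a = 0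
  simp [RSFan.mul3_apply, this]

/-- The double twist is `u g₁² g₂²`, and the squares are `1` wherever `u` is nonzero. -/
theorem RSFan.mul3_mul3_cancel {F : Type u} [RSFan F] {u g₁ g₂ : RSChar F}
    (h₁ : g₁.zeros ⊆ u.zeros) (h₂ : g₂.zeros ⊆ u.zeros) :
    RSFan.mul3 (RSFan.mul3 u g₁ g₂) g₂ g₁ = u := by
  refine DFunLike.ext _ _ fun a => ?_
  have k₁ : g₁ a = 0 → u a = 0 := fun h => h₁ h
  have k₂ : g₂ a = 0 → u a = 0 := fun h => h₂ h
  simp only [RSFan.mul3_apply]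
  revert k₁ k₂
  generalize u a = r; generalize g₁ a = s; generalize g₂ a = t
  revert r s t; decide

/-- A map between predecessor fans of the form `u ↦ u g₁ g₂` is a morphism. -/
theorem predecessorFan_isMorphism {F : Type u} [RSFan F] {h₁ h₂ : RSChar F} (g₁ g₂ : RSChar F)
    (φ : predecessors h₁ → predecessors h₂) (hφ : ∀ u, (φ u).1 = RSFan.mul3 u.1 g₁ g₂) :
    AbstractRealSpectrum.IsMorphism (predecessorFan h₁) (predecessorFan h₂) φ := by
  rintro _ ⟨a, rfl⟩
  obtain ⟨b, hb⟩ := RSFan.exists_mul3_apply_eq g₁ g₂ a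
  refine ⟨b, funext fun u => ?_⟩
  change u.1 b = (φ u).1 a
  rw [hφ, hb]

/-! ### The embedding of predecessor fans -/

theorem theorem2p12 {F : Type u} [RSFan F] (I J : SemigroupIdeal F)
    (hI : I ∈ RSSpec F) (hJ : J ∈ RSSpec F) (hJI : J ≤ I)
    (h₁ h₂ : RSChar F) (hh₁ : h₁ ∈ levelC I J) (hh₂ : h₂ ∈ levelS I J) :
    ∃ φ : predecessors h₁ → predecessors h₂,
      AbstractRealSpectrum.IsEmbedding (predecessorFan h₁) (predecessorFan h₂) φ ∧
      Set.range φ = {u | (J : Set F) ⊆ u.1.zeros} ∧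
      (∀ g g' : predecessors h₁, (φ g).1 ⤳ (φ g').1 ↔ g.1 ⤳ g'.1) ∧
      (h₂ ∈ levelC I J → AbstractRealSpectrum.IsIso (predecessorFan h₁) (predecessorFan h₂) φ) := by
  obtain ⟨⟨hz₁, g₁, hg₁, hJ₁⟩, hC⟩ := hh₁
  obtain ⟨hz₂, g₂, hg₂, hJ₂⟩ := hh₂
  have hz : h₁.zeros = h₂.zeros := Eq.trans hz₁ (Eq.symm hz₂)
  let φ : predecessors h₁ → predecessors h₂ := fun u =>
    ⟨RSFan.mul3 u.1 g₁ g₂, RSFan.mul3_mem_predecessors hz u.2 hg₁ hg₂⟩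
  let ψ : predecessors h₂ → predecessors h₁ := fun u =>
    ⟨RSFan.mul3 u.1 g₂ g₁, RSFan.mul3_mem_predecessors hz.symm u.2 hg₂ hg₁⟩
  have hφ : AbstractRealSpectrum.IsMorphism (predecessorFan h₁) (predecessorFan h₂) φ :=
    predecessorFan_isMorphism g₁ g₂ φ fun _ => rfl
  have hψ : AbstractRealSpectrum.IsMorphism (predecessorFan h₂) (predecessorFan h₁) ψ :=
    predecessorFan_isMorphism g₂ g₁ ψ fun _ => rfl
  -- The minimality of `J` among zero-sets of predecessors of `h₁` makes the cancellation valid for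
  -- every `u`.
  have hψφ : Function.LeftInverse ψ φ := fun u => Subtype.ext <|
    RSFan.mul3_mul3_cancel (hJ₁.trans_subset (hC _ u.2)) (hJ₂.trans_subset (hC _ u.2))
  have hφψ : ∀ u : predecessors h₂, (J : Set F) ⊆ u.1.zeros → φ (ψ u) = u := fun u hu =>
    Subtype.ext <| RSFan.mul3_mul3_cancel (hJ₂.trans_subset hu) (hJ₁.trans_subset hu)
  -- The left inverse `ψ` is itself a morphism, so `b ∘ ψ` is an admissible function extending `b`
  -- along `φ`.
  refine ⟨φ, ⟨hφ, hψφ.injective, fun b hb => ⟨b ∘ ψ, hψ b hb, ?_⟩⟩, ?_, fun g g' => ⟨?_, ?_⟩, ?_⟩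
  · exact funext fun u => congrArg b (hψφ u)
  · ext u
    constructor
    · rintro ⟨v, rfl⟩
      exact RSFan.subset_zeros_mul3 g₁ g₂ (hC _ v.2)
    · exact fun hu => ⟨ψ u, hφψ u hu⟩
  · intro h
    -- Specialization is reflected by `φ` because its left inverse `ψ` preserves it.
    rw [← hψφ g, ← hψφ g']
    exact RSFan.mul3_specializes_mul3 g₂ g₁ h
  · exact RSFan.mul3_specializes_mul3 g₁ g₂
  · exact fun h => ⟨hφ, ψ, hψ, hψφ, fun u => hφψ u (h.2 _ u.2)⟩
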